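/- All C*-algebras are complex and unital, and are not assumed commutative. A \emph{PU-map} $f\colon A\to B$ of C*-algebras is a $\mathbb{C}$-linear map that sends positive elements (those of the form $x^*x$) to positive elements and satisfies $f(1)=1$; let $\mathbf{Cstar}_{\mathrm{PU}}$ be the category of C*-algebras and PU-maps. Let $\mathbf{CCLcvx}$ be the category whose objects are pairs $(V,X)$, with $V$ a Hausdorff locally convex real topological vector space and $X\subseteq V$ a compact convex subset, and whose morphisms $(V,X)\to(W,Y)$ are the continuous affine maps $X\to Y$. For a C*-algebra $A$ let $\mathrm{Stat}(A)$ be the set of PU-maps $A\to\mathbb{C}$, viewed as a compact convex subset of the dual space of $A$ with the weak-* topology; for a PU-map $f\colon A\to B$ let $\mathrm{Stat}(f)\colon \mathrm{Stat}(B)\to\mathrm{Stat}(A)$ be $\varphi\mapsto\varphi\circ f$. The \emph{Radon monad} $\mathcal{R}$ on the category of compact Hausdorff spaces is given by $\mathcal{R}(X)=\mathrm{Stat}(C(X))$, where $C(X)$ is the C*-algebra of continuous functions $X\to\mathbb{C}$, by $\mathcal{R}(f)(\varphi)(v)=\varphi(v\circ f)$, with unit $\eta_X(x)(v)=v(x)$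 and multiplication $\mu_X(g)(v)=g(h\mapsto h(v))$. Let $\mathcal{EM}(\mathcal{R})$ be its category of Eilenberg–Moore algebras, and let $K\colon\mathbf{CCLcvx}\to\mathcal{EM}(\mathcal{R})$ be the comparison functor, which sends $(V,X)$ to the compact Hausdorff space $X$ with structure map $\mathcal{R}(X)\to X$ sending $\varphi$ to its barycentre, i.e. to the unique $x\in X$ with $\varphi(f)=f(x)$ for all continuous affine $f\colon X\to\mathbb{R}$, and which sends a morphism to its underlying continuous map. \textbf{Theorem.} The state space functor $\mathrm{Stat}\colon(\mathbf{Cstar}_{\mathrm{PU}})^{\mathrm{op}}\to\mathbf{CCLcvx}$ is full and faithful. Hence $(\mathbf{Cstar}_{\mathrm{PU}})^{\mathrm{op}}$ embeds fully in $\mathcal{EM}(\mathcal{R})$: the composite functor $K\circ\mathrm{Stat}\colon(\mathbf{Cstar}_{\mathrm{PU}})^{\mathrm{op}}\to\mathcal{EM}(\mathcal{R})$ is full and faithful. -/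

import Mathlib

open CategoryTheory

universe u v w

noncomputable section

/-! ### C*-algebras and positive unital maps -/

/-- A PU-map between unital C*-algebras: a complex-linear map that sends positive elements, that is,
elements of the form `x⋆ x`, to positive elements, and that preserves the unit. -/
structure PUMap (A : Type u) (B : Type v) [CStarAlgebra A] [CStarAlgebra B] extends
    A →ₗ[ℂ] B where
  map_positive' : ∀ x : A, ∃ y : B, toFun (star x * x) = star y * y
  map_one' : toFun 1 = 1

namespace PUMap

variable {A : Type u} {B : Type v} {C : Type w} [CStarAlgebra A] [CStarAlgebra B] [CStarAlgebra C]

instance : FunLike (PUMap A B) A B where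
  coe f := f.toFun
  coe_injective f g h := by
    obtain ⟨f, _, _⟩ := f
    obtain ⟨g, _, _⟩ := g
    have : f = g := DFunLike.coe_injective h
    subst this
    rfl

instance : LinearMapClass (PUMap A B) ℂ A B where
  map_add f := f.map_add'
  map_smulₛₗ f := f.map_smul'

@[ext]
theorem ext {f g : PUMap A B} (h : ∀ x, f x = g x) : f = g := DFunLike.ext f g h

theorem map_positive (f : PUMap A B) (x : A) : ∃ y : B, f (star x * x) = star y * y :=
  f.map_positive' x

@[simp]
theorem map_one (f : PUMap A B) : f 1 = 1 := f.map_one'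

/-- The identity PU-map. -/
protected def id (A : Type u) [CStarAlgebra A] : PUMap A A where
  toLinearMap := LinearMap.id
  map_positive' x := ⟨x, rfl⟩
  map_one' := rfl

/-- Composition of PU-maps. -/
def comp (g : PUMap B C) (f : PUMap A B) : PUMap A C where
  toLinearMap := g.toLinearMap.comp f.toLinearMap
  map_positive' x := by
    obtain ⟨y, hy⟩ := f.map_positive x
    obtain ⟨z, hz⟩ := g.map_positive y
    exact ⟨z, (congrArg g hy).trans hz⟩
  map_one' := (congrArg g f.map_one).trans g.map_one

@[simp]
theorem id_apply (x : A) : PUMap.id A x = x := rfl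

@[simp]
theorem comp_apply (g : PUMap B C) (f : PUMap A B) (x : A) : g.comp f x = g (f x) := rfl

theorem norm_le_of_linear (f : A →ₗ[ℂ] ℂ) (hp : ∀ x : A, ∃ z : ℂ, f (star x * x) = star z * z)
    (h1 : f 1 = 1) (a : A) : ‖f a‖ ≤ 4 * ‖a‖ := by
  let _ := CStarAlgebra.spectralOrder A
  have := CStarAlgebra.spectralOrderedRing A
  open scoped ComplexOrder in
  have mono : Monotone f := by
    intro x y hxy
    obtain ⟨s, hs⟩ := CStarAlgebra.nonneg_iff_eq_star_mul_self.mp (sub_nonneg.mpr hxy)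
    obtain ⟨z, hz⟩ := hp s
    have : f y - f x = star z * z := by rw [← hz, ← hs, map_sub]
    exact sub_nonneg.mp (this ▸ star_mul_self_nonneg z)
  open scoped ComplexOrder in
  let F : A →ₚ[ℂ] ℂ := { f with monotone' := mono }
  have hF : ∀ x, F x = f x := fun _ => rfl
  obtain ⟨y, hy, hn, hs⟩ := CStarAlgebra.exists_sum_four_nonneg a
  rw [← hF]
  conv_lhs => rw [hs]
  rw [map_sum]
  refine (norm_sum_le _ _).trans ((Finset.sum_le_sum (g := fun _ => ‖a‖) fun i _ => ?_).trans
    (by simp))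
  rw [map_smul, norm_smul, norm_pow, Complex.norm_I, one_pow, one_mul]
  have := F.norm_apply_le_of_nonneg (y i) (hy i)
  rw [hF 1, h1, norm_one, one_mul] at this
  exact this.trans (hn i)

protected theorem continuous (f : PUMap A B) : Continuous f := by
  let _ := CStarAlgebra.spectralOrder A
  have := CStarAlgebra.spectralOrderedRing A
  let _ := CStarAlgebra.spectralOrder B
  have := CStarAlgebra.spectralOrderedRing B
  have mono : Monotone f := by
    intro x y hxy
    obtain ⟨s, hs⟩ := CStarAlgebra.nonneg_iff_eq_star_mul_self.mp (sub_nonneg.mpr hxy)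
    obtain ⟨z, hz⟩ := f.map_positive s
    have : f y - f x = star z * z := by rw [← hz, ← hs, map_sub]
    exact sub_nonneg.mp (this ▸ star_mul_self_nonneg z)
  let F : A →ₚ[ℂ] B := { f.toLinearMap with monotone' := mono }
  exact map_continuous F

end PUMap

/-- The category of (unital, possibly noncommutative) C*-algebras with PU-maps. -/
structure CStarPU : Type (u + 1) where
  carrier : Type u
  [cstar : CStarAlgebra carrier]

namespace CStarPU

attribute [instance] CStarPU.cstar

instance : CoeSort CStarPU.{u} (Type u) := ⟨carrier⟩

instance : Category CStarPU.{u} where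
  Hom A B := PUMap A B
  id A := PUMap.id A
  comp f g := PUMap.comp g f

end CStarPU

/-! ### Compact convex subsets of locally convex spaces -/

/-- An object of `CCLcvx`: a Hausdorff locally convex space `V` with a compact convex subset. -/
structure CCLcvx : Type (u + 1) where
  V : Type u
  [addCommGroup : AddCommGroup V]
  [module : Module ℝ V]
  [topologicalSpace : TopologicalSpace V]
  [isTopologicalAddGroup : IsTopologicalAddGroup V]
  [continuousSMul : ContinuousSMul ℝ V]
  [locallyConvexSpace : LocallyConvexSpace ℝ V]
  [t2Space : T2Space V]
  X : Set V
  isCompact : IsCompact X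
  convex : Convex ℝ X

namespace CCLcvx

attribute [instance] addCommGroup module topologicalSpace isTopologicalAddGroup continuousSMul
  locallyConvexSpace t2Space

instance : CoeSort CCLcvx.{u} (Type u) := ⟨fun K => K.X⟩

instance (K : CCLcvx.{u}) : CompactSpace K.X := isCompact_iff_compactSpace.mp K.isCompact

/-- The convex combination `a x + b y` of two points of the compact convex set. -/
def mix (K : CCLcvx.{u}) {a b : ℝ} (ha : 0 ≤ a) (hb : 0 ≤ b) (hab : a + b = 1) (x y : K) : K :=
  ⟨a • (x : K.V) + b • (y : K.V), K.convex x.2 y.2 ha hb hab⟩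

/-- A morphism of `CCLcvx`: a continuous affine map between the compact convex subsets. -/
@[ext]
structure Hom (K : CCLcvx.{u}) (L : CCLcvx.{v}) where
  toFun : K → L
  continuous_toFun : Continuous toFun
  map_mix : ∀ {a b : ℝ} (ha : 0 ≤ a) (hb : 0 ≤ b) (hab : a + b = 1) (x y : K),
    toFun (K.mix ha hb hab x y) = L.mix ha hb hab (toFun x) (toFun y)

instance : Category CCLcvx.{u} where
  Hom K L := Hom K L
  id K := ⟨id, continuous_id, fun _ _ _ _ _ => rfl⟩
  comp f g := ⟨g.toFun ∘ f.toFun, g.continuous_toFun.comp f.continuous_toFun,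
    fun ha hb hab x y => by simp only [Function.comp_apply, f.map_mix, g.map_mix]⟩

@[simp]
theorem id_toFun (K : CCLcvx.{u}) : Hom.toFun (𝟙 K) = id := rfl

@[simp]
theorem comp_toFun {K L M : CCLcvx.{u}} (f : K ⟶ L) (g : L ⟶ M) :
    Hom.toFun (f ≫ g) = Hom.toFun g ∘ Hom.toFun f := rfl

/-- The forgetful functor from `CCLcvx` to compact Hausdorff spaces. -/
def forgetToCompHaus : CCLcvx.{u} ⥤ CompHaus.{u} where
  obj K := CompHaus.of K.X
  map f := CompHausLike.ofHom _ ⟨Hom.toFun f, Hom.continuous_toFun f⟩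

end CCLcvx

/-! ### The state space functor -/

/-- The set of states of `A`, as a subset of the dual of `A` with the weak-* topology. -/
def stateSet (A : Type u) [CStarAlgebra A] : Set (WeakDual ℂ A) :=
  {φ | (∀ x : A, ∃ z : ℂ, φ (star x * x) = star z * z) ∧ φ 1 = 1}

theorem complex_positive_iff (c : ℂ) : (∃ z : ℂ, c = star z * z) ↔ 0 ≤ c.re ∧ c.im = 0 := by
  constructor
  · rintro ⟨z, rfl⟩
    constructor
    · simp only [Complex.star_def, Complex.mul_re, Complex.conj_re, Complex.conj_im]
      nlinarith [mul_self_nonneg z.re, mul_self_nonneg z.im]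
    · simp only [Complex.star_def, Complex.mul_im, Complex.conj_re, Complex.conj_im]
      ring
  · rintro ⟨h, h'⟩
    refine ⟨(Real.sqrt c.re : ℂ), ?_⟩
    rw [Complex.star_def, Complex.conj_ofReal, ← Complex.ofReal_mul, Real.mul_self_sqrt h]
    exact Complex.ext rfl h'

namespace stateSet

variable {A : Type u} {B : Type v} [CStarAlgebra A] [CStarAlgebra B]

/-- The states of `A` are exactly the PU-maps from `A` to the complex numbers. -/
def equivPUMap (A : Type u) [CStarAlgebra A] : stateSet A ≃ PUMap A ℂ where
  toFun φ := ⟨φ.1.toLinearMap, φ.2.1, φ.2.2⟩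
  invFun f := ⟨StrongDual.toWeakDual ⟨f.toLinearMap, f.continuous⟩, f.map_positive, f.map_one⟩
  left_inv _ := rfl
  right_inv _ := rfl

theorem mem_iff (φ : WeakDual ℂ A) : φ ∈ stateSet A ↔
    (∀ x : A, 0 ≤ (φ (star x * x)).re ∧ (φ (star x * x)).im = 0) ∧ φ 1 = 1 := by
  simp only [stateSet, Set.mem_ofPred_eq, complex_positive_iff]

theorem convex (A : Type u) [CStarAlgebra A] : Convex ℝ (stateSet A) := by
  intro φ hφ ψ hψ a b ha hb hab
  rw [mem_iff] at *
  have key : ∀ x : A, (a • φ + b • ψ) x = (a : ℂ) * φ x + (b : ℂ) * ψ x := fun x => by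
    change a • φ x + b • ψ x = _
    simp
  refine ⟨fun x => ?_, ?_⟩
  · obtain ⟨h1, h2⟩ := hφ.1 x
    obtain ⟨h3, h4⟩ := hψ.1 x
    rw [key]
    simp only [Complex.add_re, Complex.add_im, Complex.re_ofReal_mul, Complex.im_ofReal_mul, h2, h4]
    exact ⟨by positivity, by simp⟩
  · rw [key, hφ.2, hψ.2]
    simp only [mul_one]
    exact_mod_cast hab

theorem isCompact (A : Type u) [CStarAlgebra A] : IsCompact (stateSet A) := by
  have hcont : ∀ x : A, Continuous fun φ : WeakDual ℂ A => φ x := fun x =>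
    WeakDual.eval_continuous x
  refine (WeakDual.isCompact_closedBall (0 : StrongDual ℂ A) 4).of_isClosed_subset ?_ ?_
  · have : stateSet A =
        (⋂ x : A, {φ : WeakDual ℂ A | 0 ≤ (φ (star x * x)).re} ∩
          {φ : WeakDual ℂ A | (φ (star x * x)).im = 0}) ∩ {φ : WeakDual ℂ A | φ 1 = 1} := by
      ext φ
      rw [mem_iff]
      simp
    rw [this]
    refine (isClosed_iInter fun x => ?_).inter (isClosed_eq (hcont 1) continuous_const)
    exact (isClosed_le continuous_const (Complex.continuous_re.comp (hcont _))).inter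
      (isClosed_eq (Complex.continuous_im.comp (hcont _)) continuous_const)
  · intro φ hφ
    rw [Set.mem_preimage, mem_closedBall_zero_iff]
    exact ContinuousLinearMap.opNorm_le_bound _ (by norm_num) fun a =>
      PUMap.norm_le_of_linear φ.toLinearMap hφ.1 hφ.2 a

instance (A : Type u) [CStarAlgebra A] : CompactSpace (stateSet A) :=
  isCompact_iff_compactSpace.mp (isCompact A)

end stateSet

/-- The state space of a C*-algebra as an object of `CCLcvx`. -/
def stateSpace (A : Type u) [CStarAlgebra A] : CCLcvx.{u} where
  V := WeakDual ℂ A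
  continuousSMul := ⟨WeakDual.continuous_of_continuous_eval fun a =>
    continuous_fst.smul ((WeakDual.eval_continuous a).comp continuous_snd)⟩
  locallyConvexSpace :=
    inferInstanceAs (LocallyConvexSpace ℝ (WeakBilin (topDualPairing ℂ A)))
  X := stateSet A
  isCompact := stateSet.isCompact A
  convex := stateSet.convex A

@[ext]
theorem stateSet_ext {A : Type u} [CStarAlgebra A] {φ ψ : stateSet A}
    (h : ∀ a : A, φ.1 a = ψ.1 a) : φ = ψ :=
  Subtype.ext (ContinuousLinearMap.ext h)

theorem stateSet_eval_continuous {A : Type u} [CStarAlgebra A] (a : A) :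
    Continuous fun φ : stateSet A => φ.1 a :=
  (WeakDual.eval_continuous a).comp continuous_subtype_val

theorem stateSet_continuous_iff {Y : Type v} [TopologicalSpace Y] {A : Type u} [CStarAlgebra A]
    {f : Y → stateSet A} : Continuous f ↔ ∀ a : A, Continuous fun y => (f y).1 a :=
  ⟨fun h a => (stateSet_eval_continuous a).comp h, fun h =>
    Continuous.subtype_mk (WeakDual.continuous_of_continuous_eval fun a => h a) fun y => (f y).2⟩

theorem stateSet_mix_apply {A : Type u} [CStarAlgebra A] {a b : ℝ} (ha : 0 ≤ a) (hb : 0 ≤ b)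
    (hab : a + b = 1) (φ ψ : stateSet A) (x : A) :
    (show stateSet A from (stateSpace A).mix ha hb hab φ ψ).1 x = a • φ.1 x + b • ψ.1 x := rfl

/-- Precomposition with a PU-map, as a continuous affine map between state spaces. -/
def PUMap.precomp {A B : Type u} [CStarAlgebra A] [CStarAlgebra B] (f : PUMap A B) :
    stateSpace B ⟶ stateSpace A where
  toFun φ := (stateSet.equivPUMap A).symm (((stateSet.equivPUMap B) φ).comp f)
  continuous_toFun := stateSet_continuous_iff.mpr fun a => stateSet_eval_continuous (f a)
  map_mix _ _ _ _ _ := rfl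

@[simp]
theorem PUMap.precomp_apply {A B : Type u} [CStarAlgebra A] [CStarAlgebra B] (f : PUMap A B)
    (φ : stateSet B) (a : A) :
    (show stateSet A from f.precomp.toFun φ).1 a = φ.1 (f a) := rfl

/-- The state space functor. -/
def Stat : CStarPU.{u}ᵒᵖ ⥤ CCLcvx.{u} where
  obj A := stateSpace A.unop
  map f := PUMap.precomp f.unop
  map_id _ := rfl
  map_comp _ _ := rfl

/-! ### The Radon monad -/

/-- Precomposition with a continuous map, as a PU-map between algebras of continuous functions. -/
def ContinuousMap.precompPU {X Y : Type u} [TopologicalSpace X] [CompactSpace X]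
    [TopologicalSpace Y] [CompactSpace Y] (f : C(X, Y)) : PUMap C(Y, ℂ) C(X, ℂ) where
  toFun h := h.comp f
  map_add' _ _ := rfl
  map_smul' _ _ := rfl
  map_positive' h := ⟨h.comp f, rfl⟩
  map_one' := rfl

/-- The functor `X ↦ C(X)` from compact Hausdorff spaces to C*-algebras with PU-maps. -/
def contFunctor : CompHaus.{u} ⥤ CStarPU.{u}ᵒᵖ where
  obj X := Opposite.op ⟨C(X, ℂ)⟩
  map f := Quiver.Hom.op (ContinuousMap.precompPU (ConcreteCategory.hom f))

/-- Evaluation `a ↦ (φ ↦ φ a)`, as a PU-map from `A` to the continuous functions on its states. -/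
def evalPU (A : Type u) [CStarAlgebra A] : PUMap A C(stateSet A, ℂ) where
  toFun a := ⟨fun φ => φ.1 a, stateSet_eval_continuous a⟩
  map_add' a b := ContinuousMap.ext fun φ => map_add φ.1 a b
  map_smul' c a := ContinuousMap.ext fun φ => map_smul φ.1 c a
  map_positive' a := by
    refine ⟨⟨fun φ => (Real.sqrt (φ.1 (star a * a)).re : ℂ), Complex.continuous_ofReal.comp
      (Real.continuous_sqrt.comp (Complex.continuous_re.comp
        (stateSet_eval_continuous (star a * a))))⟩, ContinuousMap.ext fun φ => ?_⟩
    obtain ⟨h, h'⟩ := ((stateSet.mem_iff φ.1).mp φ.2).1 a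
    change φ.1 (star a * a) = star (Real.sqrt (φ.1 (star a * a)).re : ℂ) * _
    rw [Complex.star_def, Complex.conj_ofReal]
    change _ = (Real.sqrt (φ.1 (star a * a)).re : ℂ) * (Real.sqrt (φ.1 (star a * a)).re : ℂ)
    rw [← Complex.ofReal_mul, Real.mul_self_sqrt h]
    exact Complex.ext rfl h'
  map_one' := ContinuousMap.ext fun φ => φ.2.2

@[simp]
theorem evalPU_apply {A : Type u} [CStarAlgebra A] (a : A) (φ : stateSet A) :
    evalPU A a φ = φ.1 a := rfl

/-- The Dirac state at a point: `h ↦ h x`. -/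
def dirac {X : Type u} [TopologicalSpace X] [CompactSpace X] (x : X) : stateSet C(X, ℂ) :=
  (stateSet.equivPUMap C(X, ℂ)).symm
    { toFun := fun h => h x
      map_add' := fun _ _ => rfl
      map_smul' := fun _ _ => rfl
      map_positive' := fun h => ⟨h x, rfl⟩
      map_one' := rfl }

@[simp]
theorem dirac_apply {X : Type u} [TopologicalSpace X] [CompactSpace X] (x : X) (h : C(X, ℂ)) :
    (dirac x).1 h = h x := rfl

/-- The Radon monad on compact Hausdorff spaces: `R X` is the state space of `C(X)`, the unit is
`x ↦ (h ↦ h x)` and the multiplication is `g ↦ (v ↦ g (h ↦ h v))`. -/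
def radonMonad : Monad CompHaus.{u} where
  toFunctor := contFunctor ⋙ Stat ⋙ CCLcvx.forgetToCompHaus
  η :=
    { app := fun _ => CompHausLike.ofHom _
        ⟨dirac, stateSet_continuous_iff.mpr fun h => ContinuousMap.continuous h⟩
      naturality := fun _ _ _ => rfl }
  μ :=
    { app := fun X => CCLcvx.forgetToCompHaus.map (PUMap.precomp (evalPU C(X, ℂ)))
      naturality := fun _ _ _ => rfl }
  assoc _ := rfl
  left_unit _ := rfl
  right_unit _ := rfl

@[simp]
theorem radonMonad_η_app (X : CompHaus.{u}) (x : X) (h : C(X, ℂ)) :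
    (show stateSet C(X, ℂ) from radonMonad.η.app X x).1 h = h x := rfl

theorem radonMonad_μ_app (X : CompHaus.{u}) (g : stateSet C(stateSet C(X, ℂ), ℂ))
    (v : C(X, ℂ)) :
    (show stateSet C(X, ℂ) from radonMonad.μ.app X g).1 v =
      g.1 ⟨fun h : stateSet C(X, ℂ) => h.1 v, stateSet_eval_continuous v⟩ := rfl

theorem radonMonad_map (X Y : CompHaus.{u}) (f : X ⟶ Y) (φ : stateSet C(X, ℂ)) (v : C(Y, ℂ)) :
    (show stateSet C(Y, ℂ) from radonMonad.map f φ).1 v =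
      φ.1 (v.comp (ConcreteCategory.hom f)) := rfl

/-! ### Barycentres and the comparison with Eilenberg-Moore algebras -/

/-- A real-valued continuous function, regarded as a complex-valued one. -/
def ContinuousMap.toComplex {X : Type u} [TopologicalSpace X] (f : C(X, ℝ)) : C(X, ℂ) :=
  ⟨fun x => (f x : ℂ), Complex.continuous_ofReal.comp f.continuous⟩

@[simp]
theorem ContinuousMap.toComplex_apply {X : Type u} [TopologicalSpace X] (f : C(X, ℝ)) (x : X) :
    f.toComplex x = (f x : ℂ) := rfl

theorem stateSet.apply_nonneg {X : Type u} [TopologicalSpace X] [CompactSpace X]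
    (φ : stateSet C(X, ℂ)) (f : C(X, ℝ)) (hf : ∀ x, 0 ≤ f x) :
    0 ≤ (φ.1 f.toComplex).re ∧ (φ.1 f.toComplex).im = 0 := by
  let g : C(X, ℝ) := ⟨fun x => Real.sqrt (f x), Real.continuous_sqrt.comp f.continuous⟩
  have : f.toComplex = star g.toComplex * g.toComplex := by
    ext x
    change (f x : ℂ) = star (Real.sqrt (f x) : ℂ) * (Real.sqrt (f x) : ℂ)
    rw [Complex.star_def, Complex.conj_ofReal, ← Complex.ofReal_mul, Real.mul_self_sqrt (hf x)]
  rw [this]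
  exact ((stateSet.mem_iff φ.1).mp φ.2).1 g.toComplex

theorem stateSet.apply_im {X : Type u} [TopologicalSpace X] [CompactSpace X]
    (φ : stateSet C(X, ℂ)) (f : C(X, ℝ)) : (φ.1 f.toComplex).im = 0 := by
  let g : C(X, ℝ) := ⟨fun x => f x + ‖f‖, f.continuous.add continuous_const⟩
  have hg : ∀ x, 0 ≤ g x := fun x => by
    have := neg_le_of_abs_le (f.norm_coe_le_norm x)
    change 0 ≤ f x + ‖f‖
    linarith
  have : f.toComplex = g.toComplex - (‖f‖ : ℂ) • (1 : C(X, ℂ)) := by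
    ext x
    change (f x : ℂ) = ((f x + ‖f‖ : ℝ) : ℂ) - (‖f‖ : ℂ) • (1 : ℂ)
    simp
  rw [this, map_sub, map_smul, φ.2.2, Complex.sub_im, (stateSet.apply_nonneg φ g hg).2]
  simp

namespace CCLcvx

/-- A real-valued continuous function on a compact convex set is affine. -/
def IsAffine (K : CCLcvx.{u}) (f : C(K, ℝ)) : Prop :=
  ∀ {a b : ℝ} (ha : 0 ≤ a) (hb : 0 ≤ b) (hab : a + b = 1) (x y : K),
    f (K.mix ha hb hab x y) = a * f x + b * f y

/-- `x` is a barycentre of the state `φ` on `C(K)`: every real-valued continuous affine function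
`f` on `K` satisfies `φ f = f x`. -/
def IsBarycentre (K : CCLcvx.{u}) (φ : stateSet C(K, ℂ)) (x : K) : Prop :=
  ∀ f : C(K, ℝ), K.IsAffine f → φ.1 f.toComplex = (f x : ℂ)

theorem IsBarycentre.unique {K : CCLcvx.{u}} {φ : stateSet C(K, ℂ)} {x y : K}
    (hx : K.IsBarycentre φ x) (hy : K.IsBarycentre φ y) : x = y := by
  by_contra hne
  obtain ⟨f, hf⟩ := geometric_hahn_banach_point_point (fun h => hne (Subtype.ext h) :
    (x : K.V) ≠ (y : K.V))
  let g : C(K, ℝ) := ⟨fun z => f z, f.continuous.comp continuous_subtype_val⟩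
  have hg : K.IsAffine g := fun ha hb hab z w => by
    change f (_ • (z : K.V) + _ • (w : K.V)) = _
    rw [map_add, map_smul, map_smul]
    rfl
  have := (hx g hg).symm.trans (hy g hg)
  exact hf.ne (by exact_mod_cast this)

theorem exists_isBarycentre (K : CCLcvx.{u}) (φ : stateSet C(K, ℂ)) :
    ∃ x : K, K.IsBarycentre φ x := by
  let S : {f : C(K, ℝ) // K.IsAffine f} → Set K := fun f => {x | f.1 x = (φ.1 f.1.toComplex).re}
  suffices h : (Set.univ ∩ ⋂ f, S f).Nonempty by
    obtain ⟨x, -, hx⟩ := h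
    refine ⟨x, fun f hf => ?_⟩
    have := Set.mem_iInter.mp hx ⟨f, hf⟩
    exact Complex.ext this.symm (stateSet.apply_im φ f)
  refine isCompact_univ.inter_iInter_nonempty S
    (fun f => isClosed_eq f.1.continuous continuous_const) fun t => ?_
  let F : K → t → ℝ := fun x f => f.1.1 x
  let p : t → ℝ := fun f => (φ.1 f.1.1.toComplex).re
  have hF : Continuous F := continuous_pi fun f => f.1.1.continuous
  suffices h : p ∈ Set.range F by
    obtain ⟨x, hx⟩ := h
    exact ⟨x, trivial, Set.mem_iInter₂.mpr fun f hf => congrFun hx ⟨f, hf⟩⟩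
  by_contra hp
  classical
  have hconv : Convex ℝ (Set.range F) := by
    rintro _ ⟨x, rfl⟩ _ ⟨y, rfl⟩ a b ha hb hab
    exact ⟨K.mix ha hb hab x y, funext fun f => f.1.2 ha hb hab x y⟩
  obtain ⟨l, s, hl, hs⟩ := geometric_hahn_banach_point_closed hconv
    (isCompact_range hF).isClosed hp
  have hsum : ∀ y : t → ℝ, l y = ∑ f, y f * l (Pi.single f 1) := fun y => by
    conv_lhs => rw [← Finset.univ_sum_single y]
    rw [map_sum]
    refine Finset.sum_congr rfl fun f _ => ?_
    rw [← smul_eq_mul, ← map_smul, ← Pi.single_smul, smul_eq_mul, mul_one]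
  let g : C(K, ℝ) := ⟨fun x => l (F x) - s, (l.continuous.comp hF).sub continuous_const⟩
  have hg : ∀ x, 0 ≤ g x := fun x => sub_nonneg.mpr (hs _ ⟨x, rfl⟩).le
  have hgs : g.toComplex =
      ∑ f : t, ((l (Pi.single f 1) : ℝ) : ℂ) • f.1.1.toComplex - (s : ℂ) • (1 : C(K, ℂ)) := by
    ext x
    change ((l (F x) - s : ℝ) : ℂ) = _
    rw [hsum, ContinuousMap.sub_apply, ContinuousMap.sum_apply]
    simp only [ContinuousMap.smul_apply, ContinuousMap.one_apply, ContinuousMap.toComplex_apply,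
      smul_eq_mul, mul_one, Complex.ofReal_sub, Complex.ofReal_sum, Complex.ofReal_mul]
    congr 1
    exact Finset.sum_congr rfl fun f _ => mul_comm _ _
  have hval : (φ.1 g.toComplex).re = l p - s := by
    rw [hgs, map_sub, map_sum, map_smul, φ.2.2, Complex.sub_re, Complex.re_sum, hsum]
    simp only [map_smul, smul_eq_mul, Complex.re_ofReal_mul, mul_one]
    congr 1
    exact Finset.sum_congr rfl fun f _ => mul_comm _ _
  have := (stateSet.apply_nonneg φ g hg).1
  linarith

/-- The barycentre map. -/
def barycentre (K : CCLcvx.{u}) (φ : stateSet C(K, ℂ)) : K := (K.exists_isBarycentre φ).choose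

theorem isBarycentre_barycentre (K : CCLcvx.{u}) (φ : stateSet C(K, ℂ)) :
    K.IsBarycentre φ (K.barycentre φ) := (K.exists_isBarycentre φ).choose_spec

theorem IsBarycentre.barycentre_eq {K : CCLcvx.{u}} {φ : stateSet C(K, ℂ)} {x : K}
    (h : K.IsBarycentre φ x) : K.barycentre φ = x := (K.isBarycentre_barycentre φ).unique h

theorem continuous_barycentre (K : CCLcvx.{u}) : Continuous K.barycentre := by
  refine continuous_iff_isClosed.mpr fun C hC => ?_
  have hclosed : IsClosed {q : stateSet C(K, ℂ) × K | K.IsBarycentre q.1 q.2} := by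
    simp only [IsBarycentre, Set.ofPred_forall]
    exact isClosed_iInter fun f => isClosed_iInter fun _ => isClosed_eq
      ((stateSet_eval_continuous f.toComplex).comp continuous_fst)
      (Complex.continuous_ofReal.comp (f.continuous.comp continuous_snd))
  have : K.barycentre ⁻¹' C =
      Prod.fst '' ({q : stateSet C(K, ℂ) × K | K.IsBarycentre q.1 q.2} ∩ Prod.snd ⁻¹' C) := by
    ext φ
    constructor
    · exact fun h => ⟨(φ, K.barycentre φ), ⟨K.isBarycentre_barycentre φ, h⟩, rfl⟩
    · rintro ⟨⟨ψ, x⟩, ⟨h, hx⟩, rfl⟩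
      have e : K.barycentre ψ = x := IsBarycentre.barycentre_eq h
      rw [Set.mem_preimage, e]
      exact hx
  rw [this]
  exact isClosedMap_fst_of_compactSpace _ (hclosed.inter (hC.preimage continuous_snd))

/-- The comparison functor from `CCLcvx` to the Eilenberg-Moore algebras of the Radon monad: a
compact convex set is sent to its underlying space with the barycentre map as structure map. -/
def toRadonAlgebra : CCLcvx.{u} ⥤ radonMonad.{u}.Algebra where
  obj K :=
    { A := forgetToCompHaus.obj K
      a := CompHausLike.ofHom _ ⟨K.barycentre, K.continuous_barycentre⟩
      unit := by
        ext x
        exact IsBarycentre.barycentre_eq (φ := dirac x) fun f _ => rfl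
      assoc := by
        ext Φ
        refine IsBarycentre.barycentre_eq fun f hf => ?_
        refine Eq.trans ?_ (K.isBarycentre_barycentre
          (PUMap.precomp (ContinuousMap.precompPU ⟨K.barycentre, K.continuous_barycentre⟩) |>.toFun
            Φ) f hf)
        refine congrArg (fun k => (show stateSet C(stateSet C(K, ℂ), ℂ) from Φ).1 k)
          (ContinuousMap.ext fun φ => ?_)
        exact K.isBarycentre_barycentre φ f hf }
  map {K L} f :=
    { f := forgetToCompHaus.map f
      h := by
        refine ConcreteCategory.hom_ext _ _ fun φ => ?_
        refine IsBarycentre.barycentre_eq fun g hg => ?_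
        exact K.isBarycentre_barycentre φ (g.comp ⟨Hom.toFun f, Hom.continuous_toFun f⟩)
          fun ha hb hab x y =>
            (congrArg g (Hom.map_mix f ha hb hab x y)).trans (hg ha hb hab _ _) }
  map_id _ := rfl
  map_comp _ _ := rfl

end CCLcvx

end

/-! States see everything about a C*-algebra `A`: Hahn–Banach separation from the closed positive
cone shows that a self-adjoint element is positive once all states are nonnegative on it
(`nonneg_of_forall`), so states also bound norms of self-adjoint elements and separate points
(`norm_le_of_forall`, `eq_of_forall`). Separation of points gives faithfulness of `Stat`.

Fullness is Kadison's theorem (`exists_isSelfAdjoint_eq_eval`): every continuous affine real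
function on the state space is evaluation at a self-adjoint element. A continuous affine `g` between
state spaces then pulls each evaluation at `a` back to evaluation at some `T a`, and `T` is a PU-map
because linearity, positivity and unitality can all be tested on states.

The comparison functor is fully faithful because an algebra structure on a compact convex set
remembers its convex combinations, as barycentres of mixtures of Dirac states
(`barycentre_mix_dirac`). -/

noncomputable section

open scoped ComplexStarModule

/-! ### States determine order, norm and equality in a C*-algebra. -/

namespace stateSet

variable {A : Type u} [CStarAlgebra A]

section Order

variable [PartialOrder A] [StarOrderedRing A]

theorem nonneg_of_nonneg (φ : stateSet A) {a : A} (ha : 0 ≤ a) :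
    0 ≤ (φ.1 a).re ∧ (φ.1 a).im = 0 := by
  obtain ⟨s, rfl⟩ := CStarAlgebra.nonneg_iff_eq_star_mul_self.mp ha
  exact ((mem_iff φ.1).mp φ.2).1 s

/-- A nonzero positive real functional on a C*-algebra agrees on the self-adjoint elements with a
positive multiple of a state. -/
theorem exists_of_real_functional (l : StrongDual ℝ A) (hl : ∀ a : A, 0 ≤ a → 0 ≤ l a)
    (h1 : 0 < l 1) : ∃ φ : stateSet A, ∀ a : A, IsSelfAdjoint a → φ.1 a = (l a / l 1 : ℝ) := by
  -- Normalise `l`, ignore imaginary parts, then complexify to `g a - i g (i a)`. For self-adjoint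
  -- `a` the element `i a` has zero real part, so the second term drops out.
  let g : A →ₗ[ℝ] ℝ := (l 1)⁻¹ • (l.toLinearMap ∘ₗ (selfAdjoint.submodule ℝ A).subtype ∘ₗ realPart)
  have hg : ∀ a, g a = (l 1)⁻¹ * l (ℜ a : A) := fun _ => rfl
  let f : A →ₗ[ℂ] ℂ := Module.Dual.extendRCLike g
  have hf : ∀ a : A, IsSelfAdjoint a → f a = (l a / l 1 : ℝ) := fun a ha => by
    have h2 : ((ℜ (Complex.I • a) : selfAdjoint A) : A) = 0 := by
      rw [realPart_I_smul, ha.imaginaryPart, neg_zero]; rfl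
    change ((g a : ℝ) : ℂ) - Complex.I * ((g (Complex.I • a) : ℝ) : ℂ) = _
    rw [hg, hg, h2, ha.coe_realPart, map_zero]
    simp [div_eq_inv_mul]
  have hone : f 1 = 1 := by
    rw [hf 1 (IsSelfAdjoint.one A), div_self h1.ne', Complex.ofReal_one]
  have hpos : ∀ x : A, ∃ z : ℂ, f (star x * x) = star z * z := fun x => by
    rw [complex_positive_iff, hf _ (IsSelfAdjoint.star_mul_self x)]
    exact ⟨div_nonneg (hl _ (star_mul_self_nonneg x)) h1.le, Complex.ofReal_im _⟩
  exact ⟨(equivPUMap A).symm ⟨f, hpos, hone⟩, hf⟩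

/-- If `b` were outside the closed convex cone of positive elements, a real functional would
separate them; normalised at `1`, it becomes a state that is negative on `b`. -/
theorem nonneg_of_forall {b : A} (hb : IsSelfAdjoint b) (h : ∀ φ : stateSet A, 0 ≤ (φ.1 b).re) :
    0 ≤ b := by
  by_contra hneg
  have hconv : Convex ℝ {a : A | 0 ≤ a} := fun x hx y hy r s hr hs _ =>
    add_nonneg (smul_nonneg hr hx) (smul_nonneg hs hy)
  obtain ⟨l, s, hlb, hl⟩ := geometric_hahn_banach_point_closed hconv
    CStarAlgebra.isClosed_nonneg hneg
  have hs : s < 0 := by simpa using hl 0 le_rfl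
  have hpos : ∀ a : A, 0 ≤ a → 0 ≤ l a := fun a ha => by
    by_contra! hla
    -- The scaling makes the value of `l` exactly `s`, its strict lower bound on the cone.
    have := hl ((s / l a) • a) (smul_nonneg (div_nonneg_of_nonpos hs.le hla.le) ha)
    rw [map_smul, smul_eq_mul, div_mul_cancel₀ _ hla.ne] at this
    exact this.false
  have h1 : 0 < l 1 := by
    -- Since `b + ‖b‖ • 1` is positive and `l b < 0`, the value `l 1` cannot be nonpositive.
    have := hpos _ (sub_nonneg.mpr (neg_le.mp hb.neg_algebraMap_norm_le_self))
    rw [sub_neg_eq_add, Algebra.algebraMap_eq_smul_one, map_add, map_smul, smul_eq_mul] at this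
    by_contra! hle
    have := mul_nonpos_of_nonneg_of_nonpos (norm_nonneg b) hle
    linarith
  obtain ⟨φ, hφ⟩ := exists_of_real_functional l hpos h1
  have := h φ
  rw [hφ b hb, Complex.ofReal_re] at this
  exact (div_neg_of_neg_of_pos (hlb.trans hs) h1).not_ge this

end Order

theorem apply_im_of_isSelfAdjoint (φ : stateSet A) {a : A} (ha : IsSelfAdjoint a) :
    (φ.1 a).im = 0 := by
  let _ := CStarAlgebra.spectralOrder A
  have := CStarAlgebra.spectralOrderedRing A
  have h := (nonneg_of_nonneg φ (sub_nonneg.mpr ha.le_algebraMap_norm_self)).2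
  rw [map_sub, Algebra.algebraMap_eq_smul_one, ← Complex.coe_smul, map_smul, φ.2.2] at h
  simpa using h

theorem apply_realPart (φ : stateSet A) (a : A) : φ.1 (ℜ a : A) = ((φ.1 a).re : ℂ) := by
  have h1 := apply_im_of_isSelfAdjoint φ (ℜ a).2
  have h2 := apply_im_of_isSelfAdjoint φ (ℑ a).2
  refine Complex.ext ?_ (by simpa using h1)
  conv_rhs => rw [← realPart_add_I_smul_imaginaryPart a]
  simp [h2]

theorem apply_imaginaryPart (φ : stateSet A) (a : A) : φ.1 (ℑ a : A) = ((φ.1 a).im : ℂ) := by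
  have h1 := apply_im_of_isSelfAdjoint φ (ℜ a).2
  have h2 := apply_im_of_isSelfAdjoint φ (ℑ a).2
  refine Complex.ext ?_ (by simpa using h2)
  conv_rhs => rw [← realPart_add_I_smul_imaginaryPart a]
  simp [h1]

/-- Positivity tested on states gives `-r ≤ b ≤ r`, and for self-adjoint `b` one of `±‖b‖` lies in
the spectrum. -/
theorem norm_le_of_forall {b : A} (hb : IsSelfAdjoint b) {r : ℝ} (hr : 0 ≤ r)
    (h : ∀ φ : stateSet A, |(φ.1 b).re| ≤ r) : ‖b‖ ≤ r := by
  let _ := CStarAlgebra.spectralOrder A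
  have := CStarAlgebra.spectralOrderedRing A
  -- The zero algebra has empty spectrum, so the spectral argument needs `A` nontrivial.
  cases subsingleton_or_nontrivial A
  · simpa [Subsingleton.elim b 0] using hr
  have hrs : IsSelfAdjoint (algebraMap ℝ A r) := .algebraMap A (.all r)
  have hφ : ∀ φ : stateSet A, (φ.1 (algebraMap ℝ A r)).re = r := fun φ => by
    rw [Algebra.algebraMap_eq_smul_one, ← Complex.coe_smul, map_smul, φ.2.2]
    simp
  have h1 : b ≤ algebraMap ℝ A r := sub_nonneg.mp <| nonneg_of_forall (hrs.sub hb) fun φ => by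
    rw [map_sub, Complex.sub_re, hφ]
    linarith [(abs_le.mp (h φ)).2]
  have h2 : algebraMap ℝ A (-r) ≤ b := by
    rw [map_neg, neg_le_iff_add_nonneg']
    refine nonneg_of_forall (hrs.add hb) fun φ => ?_
    rw [map_add, Complex.add_re, hφ]
    linarith [(abs_le.mp (h φ)).1]
  rcases CStarAlgebra.norm_or_neg_norm_mem_spectrum hb with hm | hm
  · exact (le_algebraMap_iff_spectrum_le hb).mp h1 _ hm
  · exact neg_le_neg_iff.mp ((algebraMap_le_iff_le_spectrum hb).mp h2 _ hm)

theorem eq_of_forall {a b : A} (h : ∀ φ : stateSet A, φ.1 a = φ.1 b) : a = b := by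
  have h0 : ∀ φ : stateSet A, φ.1 (a - b) = 0 := fun φ => by rw [map_sub, h φ, sub_self]
  have hz : ∀ c : A, IsSelfAdjoint c → (∀ φ : stateSet A, φ.1 c = 0) → c = 0 := fun c hc h =>
    norm_le_zero_iff.mp (norm_le_of_forall hc le_rfl fun φ => by simp [h φ])
  rw [← sub_eq_zero, ← realPart_add_I_smul_imaginaryPart (a - b),
    hz _ (ℜ (a - b)).2 fun φ => by rw [apply_realPart φ, h0, Complex.zero_re, Complex.ofReal_zero],
    hz _ (ℑ (a - b)).2 fun φ => by
      rw [apply_imaginaryPart φ, h0, Complex.zero_im, Complex.ofReal_zero],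
    smul_zero, add_zero]

theorem exists_eq_star_mul_self {b : A} (h : ∀ φ : stateSet A, ∃ z : ℂ, φ.1 b = star z * z) :
    ∃ y : A, b = star y * y := by
  let _ := CStarAlgebra.spectralOrder A
  have := CStarAlgebra.spectralOrderedRing A
  have h' := fun φ => (complex_positive_iff _).mp (h φ)
  have hb : b = (ℜ b : A) := eq_of_forall fun φ => by
    rw [apply_realPart φ]
    exact Complex.ext rfl (h' φ).2
  have hsa : IsSelfAdjoint b := hb ▸ (ℜ b).2
  exact CStarAlgebra.nonneg_iff_eq_star_mul_self.mp (nonneg_of_forall hsa fun φ => (h' φ).1)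

end stateSet

/-! ### Approximating affine functions by functionals on the ambient space. -/

namespace CCLcvx

/-- Continuous affine functions on a compact convex set are uniform limits of restrictions of
continuous affine functions on the ambient space. -/
theorem IsAffine.exists_near {K : CCLcvx.{u}} {f : C(K, ℝ)} (hf : K.IsAffine f) {ε : ℝ}
    (hε : 0 < ε) : ∃ (l : StrongDual ℝ K.V) (c : ℝ), ∀ x : K, |f x - (l x + c)| ≤ ε := by
  rcases isEmpty_or_nonempty K with hK | ⟨⟨x₀⟩⟩
  · exact ⟨0, 0, fun x => (hK.false x).elim⟩
  -- The graph of `f` raised by `t`. A closed hyperplane strictly between the graphs of `f` and `f +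
  -- ε` will be the graph of the approximant.
  let G : ℝ → K → K.V × ℝ := fun t x => (x, f x + t)
  have hG : ∀ t, Continuous (G t) := fun t => by fun_prop
  have hconv : ∀ t, Convex ℝ (Set.range (G t)) := by
    rintro t _ ⟨x, rfl⟩ _ ⟨y, rfl⟩ a b ha hb hab
    refine ⟨K.mix ha hb hab x y, Prod.ext rfl ?_⟩
    change f _ + t = a * (f x + t) + b * (f y + t)
    rw [hf ha hb hab]
    linear_combination (-t) * hab
  have hdisj : Disjoint (Set.range (G 0)) (Set.range (G ε)) := by
    rw [Set.disjoint_iff_forall_ne]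
    rintro _ ⟨x, rfl⟩ _ ⟨y, rfl⟩ h
    have h1 : x = y := Subtype.ext (congrArg Prod.fst h)
    have h2 : f x + 0 = f y + ε := congrArg Prod.snd h
    rw [h1] at h2
    linarith
  obtain ⟨L, s, t, hs, hst, ht⟩ := geometric_hahn_banach_compact_closed (hconv 0)
    (isCompact_range (hG 0)) (hconv ε) (isCompact_range (hG ε)).isClosed hdisj
  let r : ℝ := L (0, 1)
  have hL : ∀ (x : K) (t : ℝ), L (G t x) = L ((x : K.V), 0) + (f x + t) * r := fun x t => by
    have : G t x = ((x : K.V), (0 : ℝ)) + (f x + t) • ((0 : K.V), (1 : ℝ)) := by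
      ext <;> simp [G]
    rw [this, map_add, map_smul, smul_eq_mul]
  have hs' : ∀ x : K, L ((x : K.V), 0) + f x * r < s := fun x => by
    have := hs _ ⟨x, rfl⟩
    rwa [hL, add_zero] at this
  have ht' : ∀ x : K, t < L ((x : K.V), 0) + (f x + ε) * r := fun x => by
    have := ht _ ⟨x, rfl⟩
    rwa [hL] at this
  -- The hyperplane is not vertical: over `x₀` the functional grows by `ε * r` from one graph to the
  -- other. This is where a point of `K` is needed.
  have hr : 0 < r := by
    have h1 := hs' x₀
    have h2 := ht' x₀
    have : 0 < ε * r := by linarith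
    exact (pos_iff_pos_of_mul_pos this).mp hε
  -- Solve `L (v, y) = s` for `y`; over `K` the solution lies between `f` and `f + ε`.
  refine ⟨-r⁻¹ • L.comp (.inl ℝ K.V ℝ), r⁻¹ * s, fun x => ?_⟩
  have h1 := hs' x
  have h2 := ht' x
  change |f x - (-r⁻¹ * L ((x : K.V), 0) + r⁻¹ * s)| ≤ ε
  have : f x - (-r⁻¹ * L ((x : K.V), 0) + r⁻¹ * s) =
      r⁻¹ * (L ((x : K.V), 0) + f x * r - s) := by
    field_simp
    ring
  rw [this, abs_mul, abs_of_pos (inv_pos.mpr hr), inv_mul_le_iff₀ hr, abs_le]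
  constructor <;> linarith

end CCLcvx

/-- Real continuous functionals on the weak-* dual are real parts of evaluations. -/
theorem WeakDual.exists_eq_re_eval {A : Type u} [CStarAlgebra A] (l : StrongDual ℝ (WeakDual ℂ A)) :
    ∃ a : A, ∀ φ : WeakDual ℂ A, l φ = (φ a).re := by
  have : IsScalarTower ℝ ℂ (WeakDual ℂ A) :=
    ⟨fun r c φ => ContinuousLinearMap.ext fun a => smul_assoc r c (φ a)⟩
  -- After complexification, this is the fact that the weak-* continuous complex functionals are the
  -- evaluations.
  obtain ⟨a, ha⟩ := LinearMap.dualEmbedding_surjective (topDualPairing ℂ A)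
    (StrongDual.extendRCLike (𝕜 := ℂ) l)
  refine ⟨a, fun φ => ?_⟩
  rw [← StrongDual.re_extendRCLike_apply (𝕜 := ℂ) l φ, ← ha]
  rfl

/-! ### Kadison's representation theorem and duality for PU-maps. -/

namespace stateSet

variable {A : Type u} [CStarAlgebra A]

/-- Kadison's representation theorem: the continuous affine functions on the state space are the
evaluations at self-adjoint elements. -/
theorem exists_isSelfAdjoint_eq_eval (f : C(stateSet A, ℝ)) (hf : (stateSpace A).IsAffine f) :
    ∃ b : A, IsSelfAdjoint b ∧ ∀ φ : stateSet A, φ.1 b = (f φ : ℂ) := by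
  have approx : ∀ ε : ℝ, 0 < ε → ∃ b : A, IsSelfAdjoint b ∧
      ∀ φ : stateSet A, |f φ - (φ.1 b).re| ≤ ε := fun ε hε => by
    obtain ⟨l, c, hl⟩ := hf.exists_near hε
    obtain ⟨a, ha⟩ := WeakDual.exists_eq_re_eval l
    -- States are unital, so the additive constant is itself an evaluation, at a scalar.
    refine ⟨ℜ a + algebraMap ℝ A c, (ℜ a).2.add (.algebraMap A (.all c)), fun φ => ?_⟩
    have : (φ.1 (ℜ a + algebraMap ℝ A c)).re = (φ.1 a).re + c := by
      rw [map_add, apply_realPart φ, Algebra.algebraMap_eq_smul_one, ← Complex.coe_smul, map_smul,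
        φ.2.2]
      simp
    rw [this]
    exact (congrArg (fun t : ℝ => |f φ - (t + c)| ≤ ε) (ha φ.1)).mp (hl φ)
  choose b hb hfb using fun n : ℕ => approx ((1 / 2) ^ n) (by positivity)
  -- Uniform closeness on states becomes norm closeness; the factor 2 adds the errors at `n` and
  -- `m`.
  have hdist : ∀ n m, n ≤ m → dist (b n) (b m) ≤ 2 * (1 / 2) ^ n := fun n m hnm => by
    rw [dist_eq_norm]
    refine norm_le_of_forall ((hb n).sub (hb m)) (by positivity) fun φ => ?_
    have h1 := abs_le.mp (hfb n φ)
    have h2 := abs_le.mp (hfb m φ)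
    have h3 : ((1 : ℝ) / 2) ^ m ≤ (1 / 2) ^ n :=
      pow_le_pow_of_le_one (by norm_num) (by norm_num) hnm
    rw [map_sub, Complex.sub_re, abs_le]
    constructor <;> linarith [h1.1, h1.2, h2.1, h2.2]
  have hpow : Filter.Tendsto (fun n : ℕ => ((1 : ℝ) / 2) ^ n) Filter.atTop (nhds 0) :=
    tendsto_pow_atTop_nhds_zero_of_lt_one (by norm_num) (by norm_num)
  have hcauchy : CauchySeq b := cauchySeq_of_le_tendsto_0' (fun n => 2 * (1 / 2) ^ n) hdist
    (by simpa using hpow.const_mul 2)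
  obtain ⟨c, hc⟩ := cauchySeq_tendsto_of_complete hcauchy
  have hcs : IsSelfAdjoint c :=
    (isClosed_eq continuous_star continuous_id).mem_of_tendsto hc (.of_forall fun n => hb n)
  refine ⟨c, hcs, fun φ => Complex.ext ?_ (apply_im_of_isSelfAdjoint φ hcs)⟩
  have hlim : Filter.Tendsto (fun n => (φ.1 (b n)).re) Filter.atTop (nhds (φ.1 c).re) :=
    ((Complex.continuous_re.comp (map_continuous φ.1)).tendsto c).comp hc
  have hlim' : Filter.Tendsto (fun n => (φ.1 (b n)).re) Filter.atTop (nhds (f φ)) := by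
    rw [tendsto_iff_dist_tendsto_zero]
    refine squeeze_zero (fun _ => dist_nonneg) (fun n => ?_) hpow
    rw [dist_comm]
    exact hfb n φ
  exact tendsto_nhds_unique hlim hlim'

/-- A continuous affine map between state spaces is dual to a PU-map. -/
theorem exists_precomp_eq {A B : Type u} [CStarAlgebra A] [CStarAlgebra B]
    (g : stateSpace B ⟶ stateSpace A) : ∃ f : PUMap A B, f.precomp = g := by
  let G : stateSet B → stateSet A := g.toFun
  have hG : ∀ a : A, Continuous fun φ => (G φ).1 a :=
    stateSet_continuous_iff.mp g.continuous_toFun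
  have hmix : ∀ {s t : ℝ} (hs : 0 ≤ s) (ht : 0 ≤ t) (hst : s + t = 1) (φ ψ : stateSet B) (a : A),
      (G ((stateSpace B).mix hs ht hst φ ψ)).1 a = s • (G φ).1 a + t • (G ψ).1 a :=
    fun hs ht hst φ ψ a =>
      congrArg (fun χ : stateSet A => χ.1 a) (g.map_mix hs ht hst φ ψ)
  -- Kadison's theorem is applied separately to the real and imaginary parts of `φ ↦ G φ a`.
  have hex : ∀ a : A, ∃ b : B, ∀ φ : stateSet B, φ.1 b = (G φ).1 a := fun a => by
    obtain ⟨x, -, hx⟩ := exists_isSelfAdjoint_eq_eval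
      ⟨fun φ => ((G φ).1 a).re, Complex.continuous_re.comp (hG a)⟩ fun hs ht hst φ ψ => by
        change Complex.re _ = _ * Complex.re _ + _ * Complex.re _
        rw [hmix hs ht hst φ ψ a]
        simp
    obtain ⟨y, -, hy⟩ := exists_isSelfAdjoint_eq_eval
      ⟨fun φ => ((G φ).1 a).im, Complex.continuous_im.comp (hG a)⟩ fun hs ht hst φ ψ => by
        change Complex.im _ = _ * Complex.im _ + _ * Complex.im _
        rw [hmix hs ht hst φ ψ a]
        simp
    refine ⟨x + Complex.I • y, fun φ => ?_⟩
    rw [map_add, map_smul, hx, hy, smul_eq_mul, mul_comm]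
    exact Complex.re_add_im _
  choose T hT using hex
  refine ⟨{ toFun := T
            map_add' := fun a b => eq_of_forall fun φ => ?_
            map_smul' := fun c a => eq_of_forall fun φ => ?_
            map_positive' := fun a => exists_eq_star_mul_self fun φ => ?_
            map_one' := eq_of_forall fun φ => ?_ }, ?_⟩
  · rw [hT, map_add, map_add, hT, hT]
  · rw [hT, map_smul, RingHom.id_apply, map_smul, hT]
  · exact (hT _ φ).symm ▸ (G φ).2.1 a
  · rw [hT, φ.2.2, (G φ).2.2]
  · exact CCLcvx.Hom.ext (funext fun φ => stateSet_ext fun a => hT a φ)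

end stateSet

/-! ### Full faithfulness of the two functors. -/

instance Stat_faithful : Stat.{u}.Faithful where
  map_injective {X Y _ _} h := Quiver.Hom.unop_inj <| PUMap.ext fun a =>
    stateSet.eq_of_forall fun φ =>
      congrArg (fun k : stateSpace X.unop ⟶ stateSpace Y.unop =>
        (show stateSet Y.unop from k.toFun φ).1 a) h

instance Stat_full : Stat.{u}.Full where
  map_surjective g := by
    obtain ⟨f, hf⟩ := stateSet.exists_precomp_eq g
    exact ⟨Quiver.Hom.op f, hf⟩

namespace CCLcvx

/-- Affine functions send the mixture of points to the mixture of values, which is what the mixed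
Dirac state computes. This recovers the convex structure from the structure map. -/
theorem barycentre_mix_dirac (K : CCLcvx.{u}) {a b : ℝ} (ha : 0 ≤ a) (hb : 0 ≤ b)
    (hab : a + b = 1) (x y : K) :
    K.barycentre ((stateSpace C(K, ℂ)).mix ha hb hab (dirac x) (dirac y)) =
      K.mix ha hb hab x y := by
  refine IsBarycentre.barycentre_eq fun f hf => ?_
  rw [hf ha hb hab]
  change a • (f x : ℂ) + b • (f y : ℂ) = _
  simp

instance toRadonAlgebra_faithful : toRadonAlgebra.{u}.Faithful where
  map_injective {K L _ _} h := Hom.ext <| funext fun x =>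
    congrArg (fun k : toRadonAlgebra.obj K ⟶ toRadonAlgebra.obj L =>
      ConcreteCategory.hom k.f x) h

instance toRadonAlgebra_full : toRadonAlgebra.{u}.Full where
  map_surjective {K L} g := by
    let γ : C(K, L) := ConcreteCategory.hom g.f
    have hγ : ∀ φ : stateSet C(K, ℂ),
        L.barycentre ((ContinuousMap.precompPU γ).precomp.toFun φ) = γ (K.barycentre φ) :=
      fun φ => ConcreteCategory.congr_hom g.h φ
    refine ⟨⟨γ, γ.continuous, fun ha hb hab x y => ?_⟩, rfl⟩
    -- Pushing forward along `γ` takes the mixture of Diracs at `x`, `y` to that at `γ x`, `γ y`;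
    -- compatibility with barycentres makes `γ` affine.
    refine (congrArg γ (K.barycentre_mix_dirac ha hb hab x y)).symm.trans ((hγ _).symm.trans ?_)
    exact L.barycentre_mix_dirac ha hb hab (γ x) (γ y)

end CCLcvx

end
theorem mainTheorem2 :
    (Stat.{u}.Full ∧ Stat.{u}.Faithful) ∧
      ((Stat.{u} ⋙ CCLcvx.toRadonAlgebra.{u}).Full ∧
        (Stat.{u} ⋙ CCLcvx.toRadonAlgebra.{u}).Faithful) := by
  exact ⟨⟨inferInstance, inferInstance⟩, inferInstance, inferInstance⟩
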